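/- Let $K$ be an infinite field and $\Lambda$ a finite-dimensional hereditary $K$-algebra. Let $S_1,\dots,S_n$ be a complete list of pairwise non-isomorphic simple $\Lambda$-modules, $P_i$ the projective cover of $S_i$, and $P(\alpha)=\bigoplus_i P_i^{\alpha_i}$ for $\alpha\in\mathbb N^n$. The dimension vector $\underline{\dim}\,M\in\mathbb N^n$ of a finitely generated module $M$ has $i$-th coordinate $\dim_{\operatorname{End}(P_i)}\operatorname{Hom}_\Lambda(P_i,M)$ (here $\operatorname{End}_\Lambda(P_i)\cong\operatorname{End}_\Lambda(S_i)$ is a division algebra). A finitely generated module $M$ is exceptional if $\operatorname{Ext}^1_\Lambda(M,M)=0$ and $\operatorname{End}_\Lambda(M)$ is a division algebra; a real Schur root is the dimension vector $\beta$ of an exceptional module, which is then denoted $M_\beta$. Let $d_{ji}=\dim_{\operatorname{End}(S_i)}\operatorname{Ext}^1_\Lambda(S_j,S_i)$ and choose isomorphisms $\varphi_j:\bigoplus_i P_i^{d_{ji}}\cong\operatorname{rad}P_j$ for $j=1,\dots,n$. For $\alpha\in\mathbb N^n$ they give an isomorphism $\varphi_\alpha=\bigoplus_j\varphi_j^{\alpha_j}:\bigoplus_j\bigl(\bigoplus_i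 P_i^{d_{ji}}\bigr)^{\alpha_j}\cong\operatorname{rad}P(\alpha)$. The representation space $\operatorname{Rep}(\Lambda,\alpha)$ is the $K$-vector space of all $\Lambda$-homomorphisms $f:\operatorname{rad}P(\alpha)\to P(\alpha)$ such that $f\circ\varphi_\alpha$ maps each summand $P_i$ into the summand $P_i^{\alpha_i}$ of $P(\alpha)$; it carries the Zariski topology, and $f$ represents the module $N_f=\operatorname{coker}(f-\mathrm{inc}:\operatorname{rad}P(\alpha)\to P(\alpha))$. Let $\alpha_1,\dots,\alpha_k$ be real Schur roots, with exceptional modules $M_{\alpha_1},\dots,M_{\alpha_k}$, such that $\operatorname{Ext}^1_\Lambda(M_{\alpha_i},M_{\alpha_j})=0$ for all $i,j$. Let $n_1,\dots,n_k$ be nonnegative integers and $\gamma=\sum_{i=1}^k n_i\alpha_i$. Then the generic representation in $\operatorname{Rep}(\Lambda,\gamma)$ is isomorphic to $\bigoplus_{i=1}^k M_{\alpha_i}^{n_i}$; that is, for every choice of the $\varphi_j$, the set of all $f\in\operatorname{Rep}(\Lambda,\gamma)$ with $N_f\cong\bigoplus_{i=1}^k M_{\alpha_i}^{n_i}$ is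 open and dense in $\operatorname{Rep}(\Lambda,\gamma)$. -/

import Mathlib

open CategoryTheory
open scoped ModuleCat

universe u v

namespace GenericDecomposition

/-- A ring is (left) hereditary if all its left ideals are projective. Throughout, modules are
left modules. -/
def IsHereditary (Λ : Type v) [Ring Λ] : Prop :=
  ∀ I : Ideal Λ, Module.Projective Λ I

section Modules

variable {Λ : Type v} [Ring Λ]

/-- `S 0, …, S (n - 1)` is a complete irredundant list of the simple modules up to isomorphism. -/
structure IsSimpleList {n : ℕ} (S : Fin n → ModuleCat.{v} Λ) : Prop where
  simple : ∀ i, IsSimpleModule Λ (S i)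
  irredundant : ∀ i j, Nonempty (S i ≃ₗ[Λ] S j) → i = j
  complete : ∀ T : ModuleCat.{v} Λ, IsSimpleModule Λ T → ∃ i, Nonempty (T ≃ₗ[Λ] S i)

/-- `π : P → S` is a projective cover: `P` is projective, and `π` is surjective with superfluous
kernel. -/
structure IsProjectiveCover {P S : ModuleCat.{v} Λ} (π : P →ₗ[Λ] S) : Prop where
  projective : Module.Projective Λ P
  surjective : Function.Surjective π
  superfluous : ∀ N : Submodule Λ P, N ⊔ LinearMap.ker π = ⊤ → N = ⊤

/-- The direct sum `⨁ i, (X i) ^ (a i)`. The index `⟨i, r⟩` stands for the `r`-th copy of `X i`.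
For indecomposable projectives `P i` this is the module `P(a)`. -/
abbrev PowerSum {n : ℕ} (X : Fin n → ModuleCat.{v} Λ) (a : Fin n → ℕ) : Type v :=
  ∀ x : (Σ i : Fin n, Fin (a i)), X x.1

/-- The action of `End(Y)` on `Ext¹(X, Y)` by Yoneda composition. -/
noncomputable instance extEndModule (X Y : ModuleCat.{v} Λ) :
    Module (Module.End Λ Y) (Abelian.Ext X Y 1) where
  smul a e := e.comp (Abelian.Ext.mk₀ (ModuleCat.ofHom a)) (add_zero 1)
  one_smul e := Abelian.Ext.comp_mk₀_id e
  mul_smul a b e := by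
    change e.comp (Abelian.Ext.mk₀ (ModuleCat.ofHom b ≫ ModuleCat.ofHom a)) _ =
      (e.comp (Abelian.Ext.mk₀ (ModuleCat.ofHom b)) _).comp
        (Abelian.Ext.mk₀ (ModuleCat.ofHom a)) _
    rw [← Abelian.Ext.mk₀_comp_mk₀, Abelian.Ext.comp_assoc_of_third_deg_zero]
  smul_zero a := by
    change (0 : Abelian.Ext X Y 1).comp (Abelian.Ext.mk₀ (ModuleCat.ofHom a)) _ = 0
    rw [Abelian.Ext.zero_comp]
  smul_add a e e' := Abelian.Ext.add_comp _ _ _ _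
  add_smul a b e := by
    change e.comp (Abelian.Ext.mk₀ (ModuleCat.ofHom a + ModuleCat.ofHom b)) _ = _
    rw [Abelian.Ext.mk₀_add, Abelian.Ext.comp_add]
    rfl
  zero_smul e := by
    change e.comp (Abelian.Ext.mk₀ (0 : Y ⟶ Y)) _ = 0
    rw [Abelian.Ext.mk₀_zero, Abelian.Ext.comp_zero]

/-- The numbers `d j i`, the dimension of `Ext¹(S j, S i)` over the division ring `End(S i)`. -/
noncomputable def extDim {n : ℕ} (S : Fin n → ModuleCat.{v} Λ) (j i : Fin n) : ℕ :=
  Module.finrank (Module.End Λ (S i)) (Abelian.Ext (S j) (S i) 1)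

/-- The dimension vector of `M`: its `i`-th coordinate is the dimension of `Hom(P i, M)` over
`End(P i)`, which acts on the right by precomposition (`End(P i)` is a division ring for an
indecomposable projective `P i` over a hereditary algebra). -/
noncomputable def dimVec {n : ℕ} (P : Fin n → ModuleCat.{v} Λ) (M : ModuleCat.{v} Λ) :
    Fin n → ℕ :=
  fun i => Module.finrank (Module.End Λ (P i))ᵈᵐᵃ (P i →ₗ[Λ] M)

/-- A finitely generated module `M` is exceptional if `Ext¹(M, M) = 0` and `End(M)` is a division
ring. -/
structure IsExceptional (M : ModuleCat.{v} Λ) : Prop where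
  finite : Module.Finite Λ M
  rigid : Subsingleton (Abelian.Ext M M 1)
  end_nontrivial : Nontrivial (Module.End Λ M)
  end_isUnit : ∀ f : Module.End Λ M, f ≠ 0 → IsUnit f

/-- A real Schur root is the dimension vector of an exceptional module. -/
def IsRealSchurRoot {n : ℕ} (P : Fin n → ModuleCat.{v} Λ) (β : Fin n → ℕ) : Prop :=
  ∃ M : ModuleCat.{v} Λ, IsExceptional M ∧ dimVec P M = β

/-- The radical of a finite direct sum is the direct sum of the radicals. -/
theorem jacobson_powerSum {n : ℕ} (X : Fin n → ModuleCat.{v} Λ) (a : Fin n → ℕ) :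
    Module.jacobson Λ (PowerSum X a) =
      Submodule.pi Set.univ (fun x : (Σ i : Fin n, Fin (a i)) => Module.jacobson Λ (X x.1)) := by
  refine le_antisymm (Module.jacobson_pi_le Λ _) fun p hp => ?_
  have h : p = ∑ x, LinearMap.single Λ (fun x : (Σ i : Fin n, Fin (a i)) => X x.1) x (p x) := by
    simpa using (Finset.univ_sum_single p).symm
  rw [h]
  refine Submodule.sum_mem _ fun x _ => ?_
  exact Module.le_comap_jacobson
    (LinearMap.single Λ (fun x : (Σ i : Fin n, Fin (a i)) => (X x.1 : Type v)) x)
    (hp x (Set.mem_univ x))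

/-- The isomorphism `φ_α : ⨁ j, (⨁ i, P i ^ (d j i)) ^ (α j) ≃ rad P(α)` that is `φ j` on each of
the `α j` copies of `P(d j) = ⨁ i, P i ^ (d j i)`. -/
noncomputable def radEquiv {n : ℕ} (P : Fin n → ModuleCat.{v} Λ) (d : Fin n → Fin n → ℕ)
    (φ : ∀ j, PowerSum P (d j) ≃ₗ[Λ] Module.jacobson Λ (P j)) (α : Fin n → ℕ) :
    (∀ x : (Σ j : Fin n, Fin (α j)), PowerSum P (d x.1)) ≃ₗ[Λ]
      Module.jacobson Λ (PowerSum P α) where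
  toFun p := ⟨fun x => (φ x.1 (p x) : P x.1), by
    rw [jacobson_powerSum]
    exact fun x _ => (φ x.1 (p x)).2⟩
  map_add' p q := by ext x; simp
  map_smul' r p := by ext x; simp
  invFun q x := (φ x.1).symm ⟨q.1 x, Module.jacobson_pi_le Λ _ q.2 x (Set.mem_univ x)⟩
  left_inv p := by ext x; simp
  right_inv q := by ext x; simp

/-- The module `N_f = coker (f - inc : rad P(α) → P(α))`. -/
abbrev repModule {n : ℕ} {P : Fin n → ModuleCat.{v} Λ} {α : Fin n → ℕ}
    (f : Module.jacobson Λ (PowerSum P α) →ₗ[Λ] PowerSum P α) : Type v :=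
  PowerSum P α ⧸ LinearMap.range (f - (Module.jacobson Λ (PowerSum P α)).subtype)

end Modules

section Algebras

variable (K : Type u) [Field K] {Λ : Type v} [Ring Λ] [Algebra K Λ]

/-- The `K`-space `H(Λ, α)` of all homomorphisms `⨁ j, (⨁ i, P i ^ (d j i)) ^ (α j) → P(α)` that
map every summand `P i` of the source into the summand `P i ^ (α i)` of `P(α)`. -/
def blockHom {n : ℕ} (P : Fin n → ModuleCat.{v} Λ) (d : Fin n → Fin n → ℕ) (α : Fin n → ℕ) :
    Submodule K
      ((∀ x : (Σ j : Fin n, Fin (α j)), PowerSum P (d x.1)) →ₗ[Λ] PowerSum P α) where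
  carrier := {g | ∀ (x : (Σ j : Fin n, Fin (α j))) (y : (Σ i : Fin n, Fin (d x.1 i))) (p : P y.1)
    (z : (Σ i : Fin n, Fin (α i))), z.1 ≠ y.1 → g (Pi.single x (Pi.single y p)) z = 0}
  zero_mem' := fun _ _ _ _ _ => rfl
  add_mem' := fun hg hh x y p z hz => by
    simp [hg x y p z hz, hh x y p z hz]
  smul_mem' := fun c g hg x y p z hz => by
    simp [hg x y p z hz]

/-- The representation space `Rep_φ(Λ, α)`: the `K`-space of all `f : rad P(α) → P(α)` such that
`f ∘ φ_α` lies in `H(Λ, α)`. -/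
noncomputable def Rep {n : ℕ} (P : Fin n → ModuleCat.{v} Λ) (d : Fin n → Fin n → ℕ)
    (φ : ∀ j, PowerSum P (d j) ≃ₗ[Λ] Module.jacobson Λ (P j)) (α : Fin n → ℕ) :
    Submodule K (Module.jacobson Λ (PowerSum P α) →ₗ[Λ] PowerSum P α) where
  carrier := {f | f ∘ₗ (radEquiv P d φ α).toLinearMap ∈ blockHom K P d α}
  zero_mem' := (blockHom K P d α).zero_mem
  add_mem' := fun hf hg => (blockHom K P d α).add_mem hf hg
  smul_mem' := fun c _ hf => (blockHom K P d α).smul_mem c hf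

/-- The set of all `f` in `Rep_φ(Λ, α)` such that `N_f` is isomorphic to `N`. -/
def isoLocus {n : ℕ} (P : Fin n → ModuleCat.{v} Λ) (d : Fin n → Fin n → ℕ)
    (φ : ∀ j, PowerSum P (d j) ≃ₗ[Λ] Module.jacobson Λ (P j)) (α : Fin n → ℕ)
    (N : Type v) [AddCommGroup N] [Module Λ N] : Set (Rep K P d φ α) :=
  {f | Nonempty (repModule f.1 ≃ₗ[Λ] N)}

end Algebras

/-- The polynomial functions on a `K`-vector space: the functions generated, as a `K`-algebra, by
the linear forms. -/
def polyFun (K : Type u) (V : Type v) [Field K] [AddCommGroup V] [Module K V] :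
    Subalgebra K (V → K) :=
  Algebra.adjoin K (Set.range fun l : Module.Dual K V => (l : V → K))

/-- The Zariski topology on a finite-dimensional `K`-vector space: the sets where some polynomial
function does not vanish form a basis of the open sets. -/
@[reducible]
def zariski (K : Type u) (V : Type v) [Field K] [AddCommGroup V] [Module K V] :
    TopologicalSpace V :=
  TopologicalSpace.generateFrom {U | ∃ f ∈ polyFun K V, U = {x | f x ≠ 0}}

end GenericDecomposition

/-!
Identify `f ∈ Rep(Λ, γ)` with the map `f - inc : rad P(γ) → P(γ)`. Heredity enters through the
isomorphisms `φ j`: as `rad P j` is a sum of copies of the `P i`, induction on the length shows that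
every nonzero map between two of the `P i` is injective, so that the rings `End (P i)` are division
rings and the dimension vector is additive on short exact sequences. The same isomorphisms express
`rad P j` through strictly shorter `P i`, which forces `f - inc` to be injective, so that `N_f` has
dimension vector `γ`. Conversely, bases of the spaces `Hom(P i, X)` present every finitely generated
module `X` of dimension vector `γ` as some `N_f`, so the locus `N_f ≅ N` is nonempty for
`N = ⨁ M_i ^ m_i`.

If `Ext¹(N, N) = 0`, then every map `rad P(γ) → P(γ)` is of the form `A ∘ i - i ∘ B` with
`i = f - inc` a presentation of `N`. So `(A, B) ↦ A ∘ i - i' ∘ B` is surjective for `i' = i`, and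
Cramer's rule gives an element of its kernel that is polynomial in `i'` and equal to `(1, 1)` at
`i' = i`. Where `det A` and `det B` do not vanish it identifies the cokernels of `i` and `i'`, so
the locus is open. Over an infinite field the affine space `Rep(Λ, γ)` is irreducible, and a
nonempty open subset is dense.
-/

namespace GenericDecomposition

section PolynomialMaps

variable {K : Type*} [Field K]
variable {V W X Y : Type*} [AddCommGroup V] [Module K V] [AddCommGroup W] [Module K W]
  [AddCommGroup X] [Module K X] [AddCommGroup Y] [Module K Y]

variable (K) in
/-- A polynomial map of `K`-vector spaces, that is, one whose composite with every linear form is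
a polynomial function; this makes sense in infinite dimension, without coordinates. -/
def IsPolyMap (G : V → W) : Prop :=
  ∀ l : Module.Dual K W, (fun x => l (G x)) ∈ polyFun K V

theorem dual_mem_polyFun (l : Module.Dual K V) : (fun x => l x) ∈ polyFun K V :=
  Algebra.subset_adjoin ⟨l, rfl⟩

theorem const_mem_polyFun (c : K) : (fun _ => c) ∈ polyFun K V :=
  (polyFun K V).algebraMap_mem c

namespace IsPolyMap

theorem const (w : W) : IsPolyMap K (fun _ : V => w) :=
  fun l => const_mem_polyFun (l w)

theorem linearMap (L : V →ₗ[K] W) : IsPolyMap K L :=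
  fun l => dual_mem_polyFun (l ∘ₗ L)

theorem sub {F G : V → W} (hF : IsPolyMap K F) (hG : IsPolyMap K G) :
    IsPolyMap K (fun x => F x - G x) := fun l => by
  simp only [map_sub]
  exact sub_mem (hF l) (hG l)

theorem subtype_sub_const (U : Submodule K W) (w : W) : IsPolyMap K fun x : U => (x : W) - w :=
  (IsPolyMap.linearMap U.subtype).sub (.const w)

theorem smul_const {D : V → K} (hD : D ∈ polyFun K V) (w : W) :
    IsPolyMap K (fun x => D x • w) := fun l => by
  simp only [map_smul]
  exact mul_mem hD (const_mem_polyFun (l w))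

theorem mem_polyFun_comp {G : V → W} (hG : IsPolyMap K G) {D : W → K} (hD : D ∈ polyFun K W) :
    (fun x => D (G x)) ∈ polyFun K V := by
  induction hD using Algebra.adjoin_induction with
  | mem f hf => obtain ⟨l, rfl⟩ := hf; exact hG l
  | algebraMap r => exact const_mem_polyFun r
  | add f g _ _ hf hg => exact add_mem hf hg
  | mul f g _ _ hf hg => exact mul_mem hf hg

theorem comp {F : W → X} (hF : IsPolyMap K F) {G : V → W} (hG : IsPolyMap K G) :
    IsPolyMap K (fun x => F (G x)) :=
  fun l => hG.mem_polyFun_comp (hF l)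

theorem bilinear [Module.Finite K W] (B : W →ₗ[K] X →ₗ[K] Y) {F : V → W} {G : V → X}
    (hF : IsPolyMap K F) (hG : IsPolyMap K G) : IsPolyMap K (fun x => B (F x) (G x)) := fun l => by
  let b := Module.finBasis K W
  have hexpand : (fun x => l (B (F x) (G x))) =
      ∑ i, (fun x => b.coord i (F x)) * fun x => l (B (b i) (G x)) := by
    ext x
    conv_lhs => rw [← b.sum_repr (F x)]
    simp [-Module.Basis.sum_repr]
  rw [hexpand]
  exact sum_mem fun i _ => mul_mem (hF _) (hG (l ∘ₗ B (b i)))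

end IsPolyMap

section Determinant

variable {ι : Type*}

theorem IsPolyMap.of_matrix_entries [Finite ι] {G : V → Matrix ι ι K}
    (hG : ∀ i j, (fun x => G x i j) ∈ polyFun K V) : IsPolyMap K G := fun l => by
  classical
  have := Fintype.ofFinite ι
  have hexpand : (fun x => l (G x)) =
      ∑ i, ∑ j, (fun x => G x i j) * fun _ => l (Matrix.single i j 1) := by
    ext x
    conv_lhs => rw [Matrix.matrix_eq_sum_single (G x)]
    simp only [map_sum, Finset.sum_apply, Pi.mul_apply]
    refine Finset.sum_congr rfl fun i _ => Finset.sum_congr rfl fun j _ => ?_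
    rw [← smul_eq_mul, ← map_smul, Matrix.smul_single, smul_eq_mul, mul_one]
  rw [hexpand]
  exact sum_mem fun i _ => sum_mem fun j _ => mul_mem (hG i j) (const_mem_polyFun _)

variable [Fintype ι] [DecidableEq ι]

theorem matrix_det_mem_polyFun : Matrix.det ∈ polyFun K (Matrix ι ι K) := by
  have hexpand : (Matrix.det : Matrix ι ι K → K) = ∑ σ : Equiv.Perm ι,
      (Equiv.Perm.sign σ : ℤ) • ∏ i, fun T => T (σ i) i := by
    ext T
    simp [Matrix.det_apply, Units.smul_def]
  rw [hexpand]
  exact sum_mem fun σ _ => zsmul_mem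
    (prod_mem fun i _ => dual_mem_polyFun (Matrix.entryLinearMap K K (σ i) i)) _

theorem isPolyMap_adjugate : IsPolyMap K (Matrix.adjugate : Matrix ι ι K → Matrix ι ι K) := by
  refine IsPolyMap.of_matrix_entries fun i j => ?_
  simp only [Matrix.adjugate_apply]
  refine IsPolyMap.mem_polyFun_comp (IsPolyMap.of_matrix_entries fun a b => ?_)
    matrix_det_mem_polyFun
  by_cases haj : a = j
  · subst haj
    simpa using const_mem_polyFun _
  · simpa [Matrix.updateRow_ne haj] using dual_mem_polyFun (Matrix.entryLinearMap K K a b)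

variable [Module.Finite K W]

theorem det_mem_polyFun : (fun T => LinearMap.det T) ∈ polyFun K (Module.End K W) := by
  let b := Module.finBasis K W
  simp only [← LinearMap.det_toMatrix b]
  exact (IsPolyMap.linearMap (LinearMap.toMatrix b b).toLinearMap).mem_polyFun_comp
    matrix_det_mem_polyFun

variable (K W) in
theorem exists_isPolyMap_adjugate : ∃ A : Module.End K W → Module.End K W,
    IsPolyMap K A ∧ ∀ T, T * A T = LinearMap.det T • 1 := by
  let b := Module.finBasis K W
  refine ⟨fun T => Matrix.toLin b b (LinearMap.toMatrix b b T).adjugate,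
    (IsPolyMap.linearMap (Matrix.toLin b b).toLinearMap).comp
      (isPolyMap_adjugate.comp (IsPolyMap.linearMap (LinearMap.toMatrix b b).toLinearMap)),
    fun T => ?_⟩
  apply (LinearMap.toMatrix b b).injective
  rw [LinearMap.toMatrix_mul, LinearMap.toMatrix_toLin, Matrix.mul_adjugate, LinearMap.det_toMatrix,
    map_smul, LinearMap.toMatrix_one]

-- Multiplying a lift of the kernel vector by the determinant of `L x ∘ R`, where `R` is a right
-- inverse of `L x₀`, clears the denominators of the correction term.
theorem exists_isPolyMap_forall_apply_eq_zero {L : V → (X →ₗ[K] W)} (hL : IsPolyMap K L) {x₀ : V}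
    (hx₀ : Function.Surjective (L x₀)) {e : X} (he : L x₀ e = 0) :
    ∃ G : V → X, IsPolyMap K G ∧ G x₀ = e ∧ ∀ x, L x (G x) = 0 := by
  obtain ⟨R, hR⟩ := (L x₀).exists_rightInverse_of_surjective (LinearMap.range_eq_top.2 hx₀)
  obtain ⟨A, hA, hmul⟩ := exists_isPolyMap_adjugate K W
  have hT : IsPolyMap K (fun x => L x ∘ₗ R) := (IsPolyMap.linearMap (LinearMap.lcomp K W R)).comp hL
  refine ⟨fun x => LinearMap.det (L x ∘ₗ R) • e - R (A (L x ∘ₗ R) (L x e)), ?_, ?_, fun x => ?_⟩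
  · have hLe : IsPolyMap K (fun x => L x e) :=
      (IsPolyMap.linearMap (LinearMap.applyₗ e)).comp hL
    exact (IsPolyMap.smul_const (hT.mem_polyFun_comp det_mem_polyFun) e).sub
      ((IsPolyMap.linearMap R).comp (IsPolyMap.bilinear LinearMap.id (hA.comp hT) hLe))
  · simp [hR, he]
  · have := LinearMap.congr_fun (hmul (L x ∘ₗ R)) (L x e)
    simp only [Module.End.mul_apply, LinearMap.comp_apply, LinearMap.smul_apply,
      Module.End.one_apply] at this
    rw [map_sub, map_smul, this, sub_self]

end Determinant

end PolynomialMaps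

section ZariskiTopology

variable {K : Type*} [Field K] {V : Type*} [AddCommGroup V] [Module K V]

theorem exists_polynomial_eval_eq_of_mem_polyFun {F : V → K} (hF : F ∈ polyFun K V) (x y : V) :
    ∃ p : Polynomial K, ∀ t : K, p.eval t = F (x + t • y) := by
  induction hF using Algebra.adjoin_induction with
  | mem f hf =>
    obtain ⟨l, rfl⟩ := hf
    exact ⟨Polynomial.C (l x) + Polynomial.C (l y) * Polynomial.X, fun t => by
      simp [mul_comm t (l y)]⟩
  | algebraMap r => exact ⟨Polynomial.C r, fun t => by simp⟩
  | add f g _ _ hf hg =>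
    obtain ⟨p, hp⟩ := hf
    obtain ⟨q, hq⟩ := hg
    exact ⟨p + q, fun t => by simp [hp, hq]⟩
  | mul f g _ _ hf hg =>
    obtain ⟨p, hp⟩ := hf
    obtain ⟨q, hq⟩ := hg
    exact ⟨p * q, fun t => by simp [hp, hq]⟩

-- Restrict both functions to the line through `x` and `y`.
theorem exists_ne_zero_and_ne_zero_of_mem_polyFun [Infinite K] {F G : V → K}
    (hF : F ∈ polyFun K V) (hG : G ∈ polyFun K V) {x y : V} (hx : F x ≠ 0) (hy : G y ≠ 0) :
    ∃ z, F z ≠ 0 ∧ G z ≠ 0 := by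
  obtain ⟨p, hp⟩ := exists_polynomial_eval_eq_of_mem_polyFun hF x (y - x)
  obtain ⟨q, hq⟩ := exists_polynomial_eval_eq_of_mem_polyFun hG x (y - x)
  have hp0 : p ≠ 0 := fun h => hx (by simpa [h] using (hp 0).symm)
  have hq0 : q ≠ 0 := fun h => hy (by simpa [h] using (hq 1).symm)
  obtain ⟨t, ht⟩ : ∃ t, (p * q).eval t ≠ 0 := by
    by_contra! h
    exact mul_ne_zero hp0 hq0 (Polynomial.funext fun t => by rw [h, Polynomial.eval_zero])
  rw [Polynomial.eval_mul, hp, hq] at ht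
  exact ⟨_, left_ne_zero_of_mul ht, right_ne_zero_of_mul ht⟩

variable (K V) in
theorem zariski_isTopologicalBasis : @TopologicalSpace.IsTopologicalBasis V (zariski K V)
    {U | ∃ f ∈ polyFun K V, U = {x | f x ≠ 0}} := by
  let _ := zariski K V
  refine ⟨?_, ?_, rfl⟩
  · rintro _ ⟨f, hf, rfl⟩ _ ⟨g, hg, rfl⟩ x ⟨hx, hx'⟩
    exact ⟨_, ⟨f * g, mul_mem hf hg, rfl⟩, mul_ne_zero hx hx',
      fun y hy => ⟨left_ne_zero_of_mul hy, right_ne_zero_of_mul hy⟩⟩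
  · exact Set.eq_univ_of_forall fun x => ⟨_, ⟨1, one_mem _, rfl⟩, by simp⟩

theorem zariski_isOpen_iff {O : Set V} : @IsOpen V (zariski K V) O ↔
    ∀ x ∈ O, ∃ F ∈ polyFun K V, F x ≠ 0 ∧ ∀ y, F y ≠ 0 → y ∈ O := by
  let _ := zariski K V
  rw [(zariski_isTopologicalBasis K V).isOpen_iff]
  refine forall₂_congr fun x _ => ⟨?_, ?_⟩
  · rintro ⟨_, ⟨F, hF, rfl⟩, hx, hO⟩
    exact ⟨F, hF, hx, fun y hy => hO hy⟩
  · rintro ⟨F, hF, hx, hO⟩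
    exact ⟨_, ⟨F, hF, rfl⟩, hx, fun y hy => hO y hy⟩

variable (K V) in
theorem zariski_preirreducibleSpace [Infinite K] : @PreirreducibleSpace V (zariski K V) := by
  let _ := zariski K V
  refine ⟨fun U U' hU hU' ⟨x, _, hx⟩ ⟨y, _, hy⟩ => ?_⟩
  obtain ⟨F, hF, hFx, hFU⟩ := zariski_isOpen_iff.1 hU x hx
  obtain ⟨G, hG, hGy, hGU⟩ := zariski_isOpen_iff.1 hU' y hy
  obtain ⟨z, hFz, hGz⟩ := exists_ne_zero_and_ne_zero_of_mem_polyFun hF hG hFx hGy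
  exact ⟨z, trivial, hFU z hFz, hGU z hGz⟩

end ZariskiTopology

section HomSpaces

theorem finrank_add_finrank_of_exact {D : Type*} [Ring D] [Nontrivial D]
    (hD : ∀ a : D, IsUnit a ∨ a = 0) {U V W : Type*} [AddCommGroup U] [AddCommGroup V]
    [AddCommGroup W] [Module D U] [Module D V] [Module D W] [Module.Finite D V]
    {i : U →ₗ[D] V} {p : V →ₗ[D] W} (hi : Function.Injective i) (hp : Function.Surjective p)
    (hip : Function.Exact i p) :
    Module.finrank D U + Module.finrank D W = Module.finrank D V := by
  let _ : DivisionRing D := .ofIsUnitOrEqZero hD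
  rw [← p.finrank_range_add_finrank_ker, LinearMap.range_eq_top.2 hp, finrank_top,
    hip.linearMap_ker_eq, LinearMap.finrank_range_of_inj hi, add_comm]

-- The library instance `DomMulAct.instNonAssocSemiringOfMulOpposite` does not unfold to this one
-- reducibly, which would keep `Dᵈᵐᵃ`-linear maps from being applied to vectors.
local instance (D : Type*) [Semiring D] : NonAssocSemiring Dᵈᵐᵃ := Semiring.toNonAssocSemiring

variable {Λ : Type*} [Ring Λ] {X Y Z : Type*} [AddCommGroup X] [Module Λ X] [AddCommGroup Y]
  [Module Λ Y] [AddCommGroup Z] [Module Λ Z]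

variable (X) in
/-- The functor `Hom(X, -)` on morphisms, with values in the right `End(X)`-modules. -/
def homMap (f : Y →ₗ[Λ] Z) : (X →ₗ[Λ] Y) →ₗ[(Module.End Λ X)ᵈᵐᵃ] (X →ₗ[Λ] Z) where
  toFun h := f ∘ₗ h
  map_add' _ _ := LinearMap.comp_add _ _ _
  map_smul' _ _ := rfl

theorem homMap_injective {f : Y →ₗ[Λ] Z} (hf : Function.Injective f) :
    Function.Injective (homMap X f) :=
  fun _ _ hab => LinearMap.ext fun x => hf (LinearMap.congr_fun hab x)

theorem homMap_exact {W : Type*} [AddCommGroup W] [Module Λ W] {i : W →ₗ[Λ] Y} {p : Y →ₗ[Λ] Z}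
    (hi : Function.Injective i) (hip : Function.Exact i p) :
    Function.Exact (homMap X i) (homMap X p) := by
  refine fun h => ⟨fun hh => ?_, ?_⟩
  · have hrange : ∀ x, h x ∈ LinearMap.range i := fun x => (hip _).1 (LinearMap.congr_fun hh x)
    let e := LinearEquiv.ofInjective i hi
    exact ⟨e.symm ∘ₗ h.codRestrict _ hrange,
      LinearMap.ext fun x => congrArg Subtype.val (e.apply_symm_apply ⟨h x, hrange x⟩)⟩
  · rintro ⟨g, rfl⟩
    exact LinearMap.ext fun x => hip.apply_apply_eq_zero (g x)

/-- The splitting `Hom(X, ∏ x, Z x) ≃ ∏ x, Hom(X, Z x)` over `End(X)`. -/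
def homPiEquiv (X : Type*) [AddCommGroup X] [Module Λ X] {ι : Type*} (Z : ι → Type*)
    [∀ x, AddCommGroup (Z x)] [∀ x, Module Λ (Z x)] :
    (X →ₗ[Λ] ∀ x, Z x) ≃ₗ[(Module.End Λ X)ᵈᵐᵃ] ∀ x, X →ₗ[Λ] Z x where
  toFun h x := LinearMap.proj x ∘ₗ h
  map_add' _ _ := rfl
  map_smul' _ _ := rfl
  invFun := LinearMap.pi
  left_inv _ := rfl
  right_inv _ := rfl

section Projective

variable [Module.Projective Λ X]

theorem homMap_surjective {p : Y →ₗ[Λ] Z} (hp : Function.Surjective p) :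
    Function.Surjective (homMap X p) :=
  fun h => Module.projective_lifting_property p h hp

-- Finitely many homomorphisms already have images spanning those of all `h : X → Y`. As `X` is
-- projective, every `h` then factors through the finite power of `X` which they define.
theorem finite_hom [IsNoetherian Λ Y] : Module.Finite (Module.End Λ X)ᵈᵐᵃ (X →ₗ[Λ] Y) := by
  classical
  obtain ⟨s, hs⟩ := CompleteLattice.IsCompactElement.exists_finset_of_le_iSup _
    ((Submodule.fg_iff_compact _).1 (IsNoetherian.noetherian (⨆ h : X →ₗ[Λ] Y, LinearMap.range h)))
    _ le_rfl
  let ev : (s → X) →ₗ[Λ] Y := LinearMap.lsum Λ (fun _ => X) ℕ fun h => h.1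
  have hev : ∀ h : X →ₗ[Λ] Y, LinearMap.range h ≤ LinearMap.range ev := fun h =>
    (le_iSup LinearMap.range h).trans <| hs.trans <| iSup₂_le fun g hg => by
      rintro _ ⟨x, rfl⟩
      exact ⟨Pi.single ⟨g, hg⟩ x, LinearMap.lsum_piSingle ..⟩
  refine ⟨s, top_le_iff.1 fun h _ => ?_⟩
  obtain ⟨q, hq⟩ := Module.projective_lifting_property ev.rangeRestrict
    (h.codRestrict _ fun x => hev h ⟨x, rfl⟩) ev.surjective_rangeRestrict
  have hsum : h = ∑ g : s, DomMulAct.mk (LinearMap.proj g ∘ₗ q : Module.End Λ X) • g.1 := by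
    ext x
    have hx : ev (q x) = h x := congrArg Subtype.val (LinearMap.congr_fun hq x)
    simpa [ev, LinearMap.lsum_apply, DomMulAct.smul_linearMap_apply] using hx.symm
  rw [hsum]
  exact sum_mem fun g _ => Submodule.smul_mem _ _ (Submodule.subset_span g.2)

end Projective

section DivisionRing

variable (hX : ∀ h : Module.End Λ X, h ≠ 0 → IsUnit h)

include hX

theorem isUnit_or_eq_zero_domMulAct (a : (Module.End Λ X)ᵈᵐᵃ) : IsUnit a ∨ a = 0 :=
  or_iff_not_imp_right.2 fun ha =>
    (hX (DomMulAct.mk.symm a) fun h => ha (DomMulAct.mk.symm.injective h)).op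

omit hX in
theorem nontrivial_domMulAct [Nontrivial X] : Nontrivial (Module.End Λ X)ᵈᵐᵃ :=
  inferInstanceAs (Nontrivial (Module.End Λ X)ᵐᵒᵖ)

attribute [local instance] nontrivial_domMulAct

variable [Nontrivial X] [Module.Projective Λ X]

theorem finrank_hom_of_exact [IsNoetherian Λ Y] {W : Type*} [AddCommGroup W] [Module Λ W]
    {i : W →ₗ[Λ] Y} {p : Y →ₗ[Λ] Z} (hi : Function.Injective i) (hp : Function.Surjective p)
    (hip : Function.Exact i p) :
    Module.finrank (Module.End Λ X)ᵈᵐᵃ (X →ₗ[Λ] W) +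
        Module.finrank (Module.End Λ X)ᵈᵐᵃ (X →ₗ[Λ] Z) =
      Module.finrank (Module.End Λ X)ᵈᵐᵃ (X →ₗ[Λ] Y) :=
  have := finite_hom (Λ := Λ) (X := X) (Y := Y)
  finrank_add_finrank_of_exact (isUnit_or_eq_zero_domMulAct hX) (homMap_injective hi)
    (homMap_surjective hp) (homMap_exact hi hip)

theorem finrank_hom_pi {ι : Type*} [Fintype ι] (Z : ι → Type*) [∀ x, AddCommGroup (Z x)]
    [∀ x, Module Λ (Z x)] [∀ x, IsNoetherian Λ (Z x)] :
    Module.finrank (Module.End Λ X)ᵈᵐᵃ (X →ₗ[Λ] ∀ x, Z x) =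
      ∑ x, Module.finrank (Module.End Λ X)ᵈᵐᵃ (X →ₗ[Λ] Z x) := by
  let _ : DivisionRing (Module.End Λ X)ᵈᵐᵃ := .ofIsUnitOrEqZero (isUnit_or_eq_zero_domMulAct hX)
  have := fun x => finite_hom (Λ := Λ) (X := X) (Y := Z x)
  exact (homPiEquiv X Z).finrank_eq.trans (Module.finrank_pi_fintype _)

theorem subsingleton_hom_of_finrank_eq_zero [IsNoetherian Λ Y]
    (h0 : Module.finrank (Module.End Λ X)ᵈᵐᵃ (X →ₗ[Λ] Y) = 0) : Subsingleton (X →ₗ[Λ] Y) := by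
  let _ : DivisionRing (Module.End Λ X)ᵈᵐᵃ := .ofIsUnitOrEqZero (isUnit_or_eq_zero_domMulAct hX)
  have := finite_hom (Λ := Λ) (X := X) (Y := Y)
  exact Module.finrank_zero_iff.1 h0

theorem finrank_hom_eq_one {p : X →ₗ[Λ] Y} (hp : Function.Surjective p) (hp0 : p ≠ 0) :
    Module.finrank (Module.End Λ X)ᵈᵐᵃ (X →ₗ[Λ] Y) = 1 := by
  let _ : DivisionRing (Module.End Λ X)ᵈᵐᵃ := .ofIsUnitOrEqZero (isUnit_or_eq_zero_domMulAct hX)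
  refine (finrank_eq_one_iff_of_nonzero' p hp0).2 fun h => ?_
  obtain ⟨a, ha⟩ := Module.projective_lifting_property p h hp
  exact ⟨DomMulAct.mk a, ha⟩

variable (Y) in
theorem exists_bijective_sum_comp [IsNoetherian Λ Y] :
    ∃ b : Fin (Module.finrank (Module.End Λ X)ᵈᵐᵃ (X →ₗ[Λ] Y)) → (X →ₗ[Λ] Y),
      Function.Bijective fun h : _ → Module.End Λ X => ∑ r, b r ∘ₗ h r := by
  let _ : DivisionRing (Module.End Λ X)ᵈᵐᵃ := .ofIsUnitOrEqZero (isUnit_or_eq_zero_domMulAct hX)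
  have := finite_hom (Λ := Λ) (X := X) (Y := Y)
  let b := Module.finBasis (Module.End Λ X)ᵈᵐᵃ (X →ₗ[Λ] Y)
  refine ⟨b, ?_⟩
  convert (b.equivFun.symm.bijective).comp
    (Function.Bijective.piMap fun _ => DomMulAct.mk.bijective) using 1
  ext h x
  simp [Module.Basis.equivFun_symm_apply, DomMulAct.smul_linearMap_apply]

end DivisionRing

end HomSpaces

section ProjectiveCovers

variable {Λ : Type v} [Ring Λ]

namespace IsProjectiveCover

variable {P S : ModuleCat.{v} Λ} {π : P →ₗ[Λ] S} (hπ : IsProjectiveCover π)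
  [IsSimpleModule Λ S]

include hπ

theorem isCoatom_ker : IsCoatom (LinearMap.ker π) :=
  LinearMap.isCoatom_ker_of_surjective hπ.surjective

theorem le_ker {N : Submodule Λ P} (hN : N ≠ ⊤) : N ≤ LinearMap.ker π := by
  by_contra h
  exact hN (hπ.superfluous N (hπ.isCoatom_ker.2 _ (right_lt_sup.2 h)))

theorem eq_ker_of_isCoatom {N : Submodule Λ P} (hN : IsCoatom N) : N = LinearMap.ker π :=
  ((hN.le_iff.1 (hπ.le_ker hN.1)).resolve_left hπ.isCoatom_ker.1).symm

theorem jacobson_eq_ker : Module.jacobson Λ P = LinearMap.ker π :=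
  le_antisymm (sInf_le hπ.isCoatom_ker) (le_sInf fun _ hN => (hπ.eq_ker_of_isCoatom hN).ge)

theorem ne_zero : π ≠ 0 := fun h => hπ.isCoatom_ker.1 (LinearMap.ker_eq_top.2 h)

theorem nontrivial : Nontrivial P :=
  have := IsSimpleModule.nontrivial Λ S
  hπ.surjective.nontrivial

theorem finite : Module.Finite Λ P := by
  obtain ⟨p, hp⟩ := DFunLike.ne_iff.1 hπ.ne_zero
  refine Module.finite_def.2 ⟨{p}, ?_⟩
  by_contra h
  exact hp (hπ.le_ker h (Submodule.subset_span (by simp)))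

theorem injective_of_surjective {Q : Type*} [AddCommGroup Q] [Module Λ Q]
    [Module.Projective Λ Q] {h : P →ₗ[Λ] Q} (hs : Function.Surjective h) (h0 : h ≠ 0) :
    Function.Injective h := by
  obtain ⟨s, hs'⟩ := Module.projective_lifting_property h LinearMap.id hs
  have hleft : Function.LeftInverse h s := LinearMap.congr_fun hs'
  have hker : LinearMap.ker h ≤ LinearMap.ker π :=
    hπ.le_ker fun h' => h0 (LinearMap.ker_eq_top.1 h')
  have hrange : LinearMap.range s = ⊤ := by
    refine hπ.superfluous _ (top_le_iff.1 fun p _ => ?_)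
    rw [← add_sub_cancel (s (h p)) p]
    exact Submodule.add_mem_sup ⟨_, rfl⟩
      (hker (by rw [LinearMap.mem_ker, map_sub, hleft, sub_self]))
  exact (hleft.rightInverse_of_surjective (LinearMap.range_eq_top.1 hrange)).injective

end IsProjectiveCover

variable {n : ℕ} {S P : Fin n → ModuleCat.{v} Λ} (hS : IsSimpleList S) {π : ∀ i, P i →ₗ[Λ] S i}
  (hπ : ∀ i, IsProjectiveCover (π i))

theorem projective_powerSum [∀ i, Module.Projective Λ (P i)] (γ : Fin n → ℕ) :
    Module.Projective Λ (PowerSum P γ) :=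
  .of_equiv (DFinsupp.linearEquivFunOnFintype (R := Λ)
    (M := fun x : (Σ i : Fin n, Fin (γ i)) => P x.1))

include hS hπ

theorem hom_simple_eq_zero {i j : Fin n} (hij : i ≠ j) (h : P i →ₗ[Λ] S j) : h = 0 := by
  have := hS.simple i
  have := hS.simple j
  by_contra h0
  have hs := LinearMap.surjective_of_ne_zero h0
  have hker := (hπ i).eq_ker_of_isCoatom (LinearMap.isCoatom_ker_of_surjective hs)
  exact hij (hS.irredundant i j ⟨(LinearMap.quotKerEquivOfSurjective _ (hπ i).surjective).symm ≪≫ₗ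
    Submodule.quotEquivOfEq _ _ hker.symm ≪≫ₗ LinearMap.quotKerEquivOfSurjective _ hs⟩)

-- A nonzero module has a cyclic submodule, which has a simple quotient `S i`; its cover
-- `P i → S i` lifts to the cyclic submodule.
theorem subsingleton_of_hom_eq_zero {X : Type v} [AddCommGroup X] [Module Λ X]
    (hX : ∀ i (h : P i →ₗ[Λ] X), h = 0) : Subsingleton X := by
  by_contra! hne
  obtain ⟨x, hx⟩ := exists_ne (0 : X)
  let T := Submodule.span Λ {x}
  have : Nontrivial T := Submodule.nontrivial_span_singleton hx
  obtain ⟨N, hN, -⟩ := (eq_top_or_exists_le_coatom (⊥ : Submodule Λ T)).resolve_left bot_ne_top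
  obtain ⟨i, ⟨e⟩⟩ := hS.complete (ModuleCat.of Λ (T ⧸ N)) (isSimpleModule_iff_isCoatom.2 hN)
  have := (hπ i).projective
  have := hS.simple i
  obtain ⟨h, hh⟩ := Module.projective_lifting_property N.mkQ (e.symm.toLinearMap ∘ₗ π i)
    N.mkQ_surjective
  have h0 : h = 0 := by
    ext p
    exact LinearMap.congr_fun (hX i (T.subtype ∘ₗ h)) p
  refine (hπ i).ne_zero (LinearMap.ext fun p => e.symm.injective ?_)
  rw [LinearMap.zero_apply, map_zero]
  have := LinearMap.congr_fun hh p
  rw [h0, LinearMap.comp_zero] at this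
  exact this.symm

theorem surjective_of_forall_exists_comp_eq {X Y : Type v} [AddCommGroup X] [Module Λ X]
    [AddCommGroup Y] [Module Λ Y] {f : X →ₗ[Λ] Y}
    (hf : ∀ i (h : P i →ₗ[Λ] Y), ∃ g : P i →ₗ[Λ] X, f ∘ₗ g = h) : Function.Surjective f := by
  have hcoker : Subsingleton (Y ⧸ LinearMap.range f) := by
    refine subsingleton_of_hom_eq_zero hS hπ fun i h => ?_
    have := (hπ i).projective
    obtain ⟨h', rfl⟩ := Module.projective_lifting_property (LinearMap.range f).mkQ h
      (Submodule.mkQ_surjective _)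
    obtain ⟨g, rfl⟩ := hf i h'
    rw [← LinearMap.comp_assoc, LinearMap.range_mkQ_comp, LinearMap.zero_comp]
  exact LinearMap.range_eq_top.1 (Submodule.Quotient.subsingleton_iff.1 hcoker)

end ProjectiveCovers

section RadicalSummands

variable {Λ : Type v} [Ring Λ] [IsArtinianRing Λ] {n : ℕ} {S P : Fin n → ModuleCat.{v} Λ}
  (hS : IsSimpleList S) {π : ∀ i, P i →ₗ[Λ] S i} (hπ : ∀ i, IsProjectiveCover (π i))
  {d : Fin n → Fin n → ℕ} (φ : ∀ j, PowerSum P (d j) ≃ₗ[Λ] Module.jacobson Λ (P j))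

include hS hπ φ

theorem length_lt_of_radical_summand {j : Fin n} (y : Σ i : Fin n, Fin (d j i)) :
    Module.length Λ (P y.1) < Module.length Λ (P j) := by
  have := hS.simple j
  have := (hπ j).finite
  let ι : P y.1 →ₗ[Λ] Module.jacobson Λ (P j) :=
    (φ j).toLinearMap ∘ₗ LinearMap.single Λ (fun y : (Σ i : Fin n, Fin (d j i)) => P y.1) y
  have hι : Function.Injective ι := (φ j).injective.comp
    (Pi.single_injective (M := fun y : (Σ i : Fin n, Fin (d j i)) => P y.1) y)
  refine (Module.length_le_of_injective ι hι).trans_lt (Submodule.length_lt ?_)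
  rw [(hπ j).jacobson_eq_ker]
  exact (hπ j).isCoatom_ker.1

-- By induction on the length of `P i`: a non-surjective `h` has its image in `rad (P i)`, and
-- then some component of `h` in a summand of `rad (P i)` is nonzero, hence injective.
theorem hom_injective {i j : Fin n} (h : P j →ₗ[Λ] P i) (h0 : h ≠ 0) : Function.Injective h := by
  induction hN : Module.length Λ (P i) using WellFoundedLT.induction generalizing i with
  | _ N ih =>
    have := hS.simple i
    have := hS.simple j
    have := (hπ i).projective
    by_cases hs : LinearMap.range h = ⊤
    · exact (hπ j).injective_of_surjective (LinearMap.range_eq_top.1 hs) h0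
    · have hrad : ∀ p, h p ∈ Module.jacobson Λ (P i) := fun p => by
        rw [(hπ i).jacobson_eq_ker]
        exact (hπ i).le_ker hs ⟨p, rfl⟩
      let ψ : P j →ₗ[Λ] PowerSum P (d i) := (φ i).symm.toLinearMap ∘ₗ h.codRestrict _ hrad
      have hψ : ∀ p, (φ i (ψ p) : P i) = h p := fun p =>
        congrArg Subtype.val ((φ i).apply_symm_apply _)
      obtain ⟨y, hy⟩ : ∃ y, LinearMap.proj y ∘ₗ ψ ≠ 0 := by
        by_contra! hall
        refine h0 (LinearMap.ext fun p => ?_)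
        have hψ0 : ψ p = 0 := funext fun y => LinearMap.congr_fun (hall y) p
        rw [← hψ, hψ0, map_zero, Submodule.coe_zero, LinearMap.zero_apply]
      have hcomp : Function.Injective (LinearMap.proj y ∘ₗ ψ) :=
        ih _ (hN ▸ length_lt_of_radical_summand hS hπ φ y) _ hy rfl
      exact fun a b hab => hcomp (congrArg (· y)
        ((φ i).injective (Subtype.ext ((hψ a).trans (hab.trans (hψ b).symm)))))

theorem end_isUnit (i : Fin n) (h : Module.End Λ (P i)) (h0 : h ≠ 0) : IsUnit h := by
  have := hS.simple i
  have := (hπ i).finite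
  exact (Module.End.isUnit_iff h).2
    (IsArtinian.bijective_of_injective_endomorphism h (hom_injective hS hπ φ h h0))

end RadicalSummands

section DimensionVectors

variable {Λ : Type v} [Ring Λ] [IsArtinianRing Λ] {n : ℕ} {S P : Fin n → ModuleCat.{v} Λ}
  (hS : IsSimpleList S) {π : ∀ i, P i →ₗ[Λ] S i} (hπ : ∀ i, IsProjectiveCover (π i))
  {d : Fin n → Fin n → ℕ} (φ : ∀ j, PowerSum P (d j) ≃ₗ[Λ] Module.jacobson Λ (P j))

include hS hπ φ

theorem dimVec_add_of_exact {X Y Z : Type v} [AddCommGroup X] [Module Λ X] [AddCommGroup Y]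
    [Module Λ Y] [AddCommGroup Z] [Module Λ Z] [IsNoetherian Λ Y] {i : X →ₗ[Λ] Y} {p : Y →ₗ[Λ] Z}
    (hi : Function.Injective i) (hp : Function.Surjective p) (hip : Function.Exact i p) :
    dimVec P (ModuleCat.of Λ X) + dimVec P (ModuleCat.of Λ Z) = dimVec P (ModuleCat.of Λ Y) := by
  ext l
  have := hS.simple l
  have := (hπ l).projective
  have := (hπ l).nontrivial
  exact finrank_hom_of_exact (end_isUnit hS hπ φ l) hi hp hip

theorem dimVec_powerSum {k : ℕ} (M : Fin k → ModuleCat.{v} Λ) [∀ i, Module.Finite Λ (M i)]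
    (m : Fin k → ℕ) :
    dimVec P (ModuleCat.of Λ (PowerSum M m)) = ∑ i, m i • dimVec P (M i) := by
  ext l
  have := hS.simple l
  have := (hπ l).projective
  have := (hπ l).nontrivial
  have hpi := finrank_hom_pi (end_isUnit hS hπ φ l)
    fun x : (Σ i : Fin k, Fin (m i)) => (M x.1 : Type v)
  rw [Fintype.sum_sigma] at hpi
  rw [Finset.sum_apply]
  exact hpi.trans (Finset.sum_congr rfl fun i _ => Fin.sum_const (m i) (dimVec P (M i) l))

theorem dimVec_simple (j : Fin n) : dimVec P (S j) = Pi.single j 1 := by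
  ext i
  have := hS.simple i
  have := (hπ i).projective
  have := (hπ i).nontrivial
  obtain rfl | hij := eq_or_ne i j
  · rw [Pi.single_eq_same]
    exact finrank_hom_eq_one (end_isUnit hS hπ φ i) (hπ i).surjective (hπ i).ne_zero
  · rw [Pi.single_eq_of_ne hij]
    have := nontrivial_domMulAct (Λ := Λ) (X := P i)
    have : Subsingleton (P i →ₗ[Λ] S j) :=
      subsingleton_of_forall_eq 0 (hom_simple_eq_zero hS hπ hij)
    exact Module.finrank_zero_of_subsingleton

theorem dimVec_powerSum_simple (γ : Fin n → ℕ) :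
    dimVec P (ModuleCat.of Λ (PowerSum S γ)) = γ := by
  have := hS.simple
  rw [dimVec_powerSum hS hπ φ]
  simp only [dimVec_simple hS hπ φ]
  ext i
  simp [Finset.sum_apply, Pi.single_apply]

theorem injective_of_surjective_of_dimVec_eq {X Y : Type v} [AddCommGroup X] [Module Λ X]
    [AddCommGroup Y] [Module Λ Y] [IsNoetherian Λ X] {η : X →ₗ[Λ] Y}
    (hη : Function.Surjective η)
    (hdim : dimVec P (ModuleCat.of Λ X) = dimVec P (ModuleCat.of Λ Y)) :
    Function.Injective η := by
  have hadd := dimVec_add_of_exact hS hπ φ (LinearMap.ker η).injective_subtype hη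
    (LinearMap.exact_subtype_ker_map η)
  rw [hdim, add_eq_right] at hadd
  have hker : Subsingleton (LinearMap.ker η) := subsingleton_of_hom_eq_zero hS hπ fun i g => by
    have := hS.simple i
    have := (hπ i).projective
    have := (hπ i).nontrivial
    have := subsingleton_hom_of_finrank_eq_zero (end_isUnit hS hπ φ i) (congrFun hadd i)
    exact Subsingleton.elim _ _
  exact LinearMap.ker_eq_bot.1 (Submodule.subsingleton_iff_eq_bot.1 hker)

end DimensionVectors

section BlockLifts

variable {Λ : Type v} [Ring Λ] {n : ℕ} {P : Fin n → ModuleCat.{v} Λ} {d : Fin n → Fin n → ℕ}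
  {γ : Fin n → ℕ} {X : Type v} [AddCommGroup X] [Module Λ X]

theorem map_eq_sum_map_single
    (g : (∀ x : (Σ j : Fin n, Fin (γ j)), PowerSum P (d x.1)) →ₗ[Λ] X) (p) :
    g p = ∑ x, ∑ y, g (Pi.single x (Pi.single y (p x y))) := by
  let single := LinearMap.single Λ fun x : (Σ j : Fin n, Fin (γ j)) => PowerSum P (d x.1)
  calc g p = ∑ x, g (single x (p x)) := by
        rw [← map_sum]
        exact congrArg g (Finset.univ_sum_single p).symm
    _ = ∑ x, ∑ y, g (Pi.single x (Pi.single y (p x y))) := Finset.sum_congr rfl fun x _ => by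
        conv_lhs => rw [← Finset.univ_sum_single (p x), map_sum, map_sum]
        rfl

/-- Blockwise lifting: every homomorphism `P i → X` lifts through `ε : P(γ) → X` to the summand
`P i ^ (γ i)` of `P(γ)`. This is what solving `ε ∘ g = v` for `g` in `blockHom` requires. -/
def HasBlockLifts (ε : PowerSum P γ →ₗ[Λ] X) : Prop :=
  ∀ i (h : P i →ₗ[Λ] X), ∃ c : P i →ₗ[Λ] PowerSum P γ,
    ε ∘ₗ c = h ∧ ∀ q (z : Σ i : Fin n, Fin (γ i)), z.1 ≠ i → c q z = 0

theorem HasBlockLifts.exists_mem_blockHom_comp_eq (K : Type u) [Field K] [Algebra K Λ]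
    {ε : PowerSum P γ →ₗ[Λ] X} (hε : HasBlockLifts ε)
    (v : (∀ x : (Σ j : Fin n, Fin (γ j)), PowerSum P (d x.1)) →ₗ[Λ] X) :
    ∃ g ∈ blockHom K P d γ, ε ∘ₗ g = v := by
  choose c hεc hc using hε
  let v' (x : Σ j : Fin n, Fin (γ j)) (y : Σ i : Fin n, Fin (d x.1 i)) : P y.1 →ₗ[Λ] X :=
    v ∘ₗ LinearMap.single Λ (fun x : (Σ j : Fin n, Fin (γ j)) => PowerSum P (d x.1)) x ∘ₗ
      LinearMap.single Λ (fun y : (Σ i : Fin n, Fin (d x.1 i)) => P y.1) y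
  let g : (∀ x : (Σ j : Fin n, Fin (γ j)), PowerSum P (d x.1)) →ₗ[Λ] PowerSum P γ :=
    LinearMap.lsum Λ _ ℕ fun x => LinearMap.lsum Λ _ ℕ fun y => c y.1 (v' x y)
  have hg : ∀ x y q, g (Pi.single x (Pi.single y q)) = c y.1 (v' x y) q := fun x y q => by
    exact (LinearMap.lsum_piSingle Λ _ ℕ _ _ _).trans (LinearMap.lsum_piSingle Λ _ ℕ _ _ _)
  refine ⟨g, fun x y q z hz => ?_, LinearMap.ext fun p => ?_⟩
  · rw [hg]
    exact hc _ _ _ _ hz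
  · rw [map_eq_sum_map_single (ε ∘ₗ g), map_eq_sum_map_single v]
    refine Finset.sum_congr rfl fun x _ => Finset.sum_congr rfl fun y _ => ?_
    rw [LinearMap.comp_apply, hg]
    exact LinearMap.congr_fun (hεc _ _) _

theorem HasBlockLifts.exists_mem_rep_comp_sub_eq_zero (K : Type u) [Field K] [Algebra K Λ]
    (φ : ∀ j, PowerSum P (d j) ≃ₗ[Λ] Module.jacobson Λ (P j))
    {ε : PowerSum P γ →ₗ[Λ] X} (hε : HasBlockLifts ε) :
    ∃ f ∈ Rep K P d φ γ, ε ∘ₗ (f - (Module.jacobson Λ (PowerSum P γ)).subtype) = 0 := by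
  let ρ := radEquiv P d φ γ
  obtain ⟨g, hg, hεg⟩ := hε.exists_mem_blockHom_comp_eq K
    (ε ∘ₗ (Module.jacobson Λ (PowerSum P γ)).subtype ∘ₗ ρ.toLinearMap)
  have hgρ : (g ∘ₗ ρ.symm.toLinearMap) ∘ₗ ρ.toLinearMap = g :=
    LinearMap.ext fun p => congrArg g (ρ.symm_apply_apply p)
  refine ⟨g ∘ₗ ρ.symm.toLinearMap, ?_, ?_⟩
  · change (g ∘ₗ ρ.symm.toLinearMap) ∘ₗ ρ.toLinearMap ∈ blockHom K P d γ
    rwa [hgρ]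
  · rw [LinearMap.comp_sub, sub_eq_zero, ← LinearMap.comp_assoc, hεg]
    exact LinearMap.ext fun q => congrArg (fun q => ε q.1) (ρ.apply_symm_apply q)

end BlockLifts

section RepresentationModules

variable {Λ : Type v} [Ring Λ] [IsArtinianRing Λ] {n : ℕ} {S P : Fin n → ModuleCat.{v} Λ}
  (hS : IsSimpleList S) {π : ∀ i, P i →ₗ[Λ] S i} (hπ : ∀ i, IsProjectiveCover (π i))
  {d : Fin n → Fin n → ℕ} (φ : ∀ j, PowerSum P (d j) ≃ₗ[Λ] Module.jacobson Λ (P j))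
  {γ : Fin n → ℕ}

include hS hπ

omit [IsArtinianRing Λ] in
theorem jacobson_powerSum_eq_ker :
    Module.jacobson Λ (PowerSum P γ) =
      LinearMap.ker (LinearMap.piMap fun x : (Σ i : Fin n, Fin (γ i)) => π x.1) := by
  have := hS.simple
  ext p
  simp only [jacobson_powerSum, fun i => (hπ i).jacobson_eq_ker, Submodule.mem_pi, Set.mem_univ,
    true_implies, LinearMap.mem_ker, funext_iff]
  rfl

include φ

theorem exists_hasBlockLifts (X : Type v) [AddCommGroup X] [Module Λ X] [IsNoetherian Λ X] :
    ∃ ε : PowerSum P (dimVec P (ModuleCat.of Λ X)) →ₗ[Λ] X, HasBlockLifts ε := by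
  have hbasis (i) : ∃ b : Fin (dimVec P (ModuleCat.of Λ X) i) → (P i →ₗ[Λ] X),
      Function.Bijective fun h : _ → Module.End Λ (P i) => ∑ r, b r ∘ₗ h r := by
    have := hS.simple i
    have := (hπ i).projective
    have := (hπ i).nontrivial
    exact exists_bijective_sum_comp X (end_isUnit hS hπ φ i)
  choose b hb using hbasis
  let ε : PowerSum P (dimVec P (ModuleCat.of Λ X)) →ₗ[Λ] X :=
    LinearMap.lsum Λ _ ℕ fun x => b x.1 x.2
  refine ⟨ε, fun i h => ?_⟩
  obtain ⟨a, rfl⟩ := (hb i).2 h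
  refine ⟨∑ r, LinearMap.single Λ (fun x : (Σ i : Fin n, Fin (dimVec P (ModuleCat.of Λ X) i)) =>
    P x.1) ⟨i, r⟩ ∘ₗ a r, ?_, fun q z hz => ?_⟩
  · ext q
    simp only [LinearMap.comp_apply, LinearMap.sum_apply, map_sum]
    exact Finset.sum_congr rfl fun r _ => LinearMap.lsum_piSingle Λ _ ℕ _ _ _
  · simp only [LinearMap.sum_apply, Finset.sum_apply]
    exact Finset.sum_eq_zero fun r _ => Pi.single_eq_of_ne (fun h => hz (congrArg Sigma.fst h)) _

variable (K : Type u) [Field K] [Algebra K Λ]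
  {f : Module.jacobson Λ (PowerSum P γ) →ₗ[Λ] PowerSum P γ}

-- If `p ≠ 0` is in the kernel of `(f - inc) ∘ φ_γ`, let `P j` be of maximal length among the
-- summands of `P(γ)` where `p` has a nonzero component. Then `f` contributes to this component
-- from copies of `P j` in the radicals of longer summands only, where `p` vanishes.
theorem sub_subtype_injective (hf : f ∈ Rep K P d φ γ) :
    Function.Injective (f - (Module.jacobson Λ (PowerSum P γ)).subtype) := by
  refine (injective_iff_map_eq_zero _).2 fun q hq => ?_
  obtain ⟨p, rfl⟩ := (radEquiv P d φ γ).surjective q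
  let g := f ∘ₗ (radEquiv P d φ γ).toLinearMap
  have hg : ∀ x, g p x = φ x.1 (p x) := fun x =>
    congrFun (sub_eq_zero.1 (LinearMap.sub_apply f _ _ ▸ hq)) x
  suffices hp : p = 0 by rw [hp, map_zero]
  by_contra hp
  obtain ⟨x₁, hx₁⟩ := Function.ne_iff.1 hp
  obtain ⟨x, hx, hmax⟩ := Set.exists_max_image {x | p x ≠ 0}
    (fun x => Module.length Λ (P x.1)) (Set.toFinite _) ⟨x₁, hx₁⟩
  refine hx ((φ x.1).map_eq_zero_iff.1 (Subtype.ext ?_))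
  rw [← hg x, map_eq_sum_map_single g p, Finset.sum_apply, Submodule.coe_zero]
  refine Finset.sum_eq_zero fun x' _ => ?_
  rw [Finset.sum_apply]
  refine Finset.sum_eq_zero fun y _ => ?_
  by_cases hy : x.1 = y.1
  · have hlt : Module.length Λ (P x.1) < Module.length Λ (P x'.1) := by
      rw [hy]
      exact length_lt_of_radical_summand hS hπ φ y
    have hp' : p x' = 0 := by
      by_contra h
      exact (hmax x' h).not_gt hlt
    rw [hp', Pi.zero_apply, Pi.single_zero, Pi.single_zero, map_zero, Pi.zero_apply]
  · exact hf x' y _ x hy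

-- `0 → rad P(γ) → P(γ) → S(γ) → 0` and `0 → rad P(γ) → P(γ) → N_f → 0` are both exact.
theorem dimVec_repModule (hf : f ∈ Rep K P d φ γ) :
    dimVec P (ModuleCat.of Λ (repModule f)) = γ := by
  have := hS.simple
  have := fun i => (hπ i).finite
  have hexact : Function.Exact (Module.jacobson Λ (PowerSum P γ)).subtype
      (LinearMap.piMap fun x : (Σ i : Fin n, Fin (γ i)) => π x.1) :=
    LinearMap.exact_iff.2 (by rw [Submodule.range_subtype, jacobson_powerSum_eq_ker hS hπ])
  have htop := dimVec_add_of_exact hS hπ φ (Submodule.subtype_injective _)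
    (Function.Surjective.piMap fun x : (Σ i : Fin n, Fin (γ i)) => (hπ x.1).surjective) hexact
  have hrep := dimVec_add_of_exact hS hπ φ (sub_subtype_injective hS hπ φ K hf)
    (Submodule.mkQ_surjective _) (LinearMap.exact_map_mkQ_range _)
  exact (add_left_cancel (hrep.trans htop.symm)).trans (dimVec_powerSum_simple hS hπ φ γ)

theorem exists_mem_rep_nonempty_repModule_equiv {X : Type v} [AddCommGroup X] [Module Λ X]
    [IsNoetherian Λ X] (hX : dimVec P (ModuleCat.of Λ X) = γ) :
    ∃ f ∈ Rep K P d φ γ, Nonempty (repModule f ≃ₗ[Λ] X) := by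
  subst hX
  have := hS.simple
  have := fun i => (hπ i).finite
  obtain ⟨ε, hε⟩ := exists_hasBlockLifts hS hπ φ X
  obtain ⟨f, hf, hεf⟩ := hε.exists_mem_rep_comp_sub_eq_zero K φ
  have hεs : Function.Surjective ε := surjective_of_forall_exists_comp_eq hS hπ fun i h =>
    (hε i h).imp fun _ => And.left
  have hs : Function.Surjective (Submodule.liftQ _ ε (LinearMap.range_le_ker_iff.2 hεf)) :=
    LinearMap.range_eq_top.1 ((Submodule.range_liftQ _ _ _).trans (LinearMap.range_eq_top.2 hεs))
  exact ⟨f, hf, ⟨.ofBijective _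
    ⟨injective_of_surjective_of_dimVec_eq hS hπ φ hs (dimVec_repModule hS hπ φ K hf), hs⟩⟩⟩

end RepresentationModules

section Rigidity

theorem subsingleton_ext_of_iso {C : Type*} [Category C] [Abelian C] [HasExt C] {X X' Y Y' : C}
    (e : X ≅ X') (e' : Y ≅ Y') {r : ℕ} [Subsingleton (Abelian.Ext X Y r)] :
    Subsingleton (Abelian.Ext X' Y' r) :=
  have : Subsingleton ((Abelian.extFunctorObj X r).obj Y) := ‹Subsingleton (Abelian.Ext X Y r)›
  (((Abelian.extFunctor r).mapIso e.op).app Y' ≪≫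
    ((Abelian.extFunctorObj X r).mapIso e').symm).addCommGroupIsoToAddEquiv.toEquiv.subsingleton

variable {Λ : Type v} [Ring Λ]

theorem subsingleton_ext_powerSum {k : ℕ} {M : Fin k → ModuleCat.{v} Λ} {r : ℕ}
    (hM : ∀ i j, Subsingleton (Abelian.Ext (M i) (M j) r)) (m : Fin k → ℕ) :
    Subsingleton
      (Abelian.Ext (ModuleCat.of Λ (PowerSum M m)) (ModuleCat.of Λ (PowerSum M m)) r) := by
  let X (x : Σ i : Fin k, Fin (m i)) : ModuleCat.{v} Λ := M x.1
  have hX (x y) : Subsingleton (Abelian.Ext (X x) (X y) r) := hM _ _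
  have hX' (x) : Subsingleton (Abelian.Ext (X x) (⨁ X) r) :=
    (Abelian.Ext.addEquivBiproduct _ (Limits.biproduct.isBilimit X) r).toEquiv.subsingleton
  have : Subsingleton (Abelian.Ext (⨁ X) (⨁ X) r) :=
    (Abelian.Ext.biproductAddEquiv (Limits.biproduct.isBilimit X) _ r).toEquiv.subsingleton
  exact subsingleton_ext_of_iso (ModuleCat.biproductIsoPi X) (ModuleCat.biproductIsoPi X)

variable {Q Y Z : Type v} [AddCommGroup Q] [Module Λ Q] [AddCommGroup Y] [Module Λ Y]
  [AddCommGroup Z] [Module Λ Z] {i : Q →ₗ[Λ] Y} (hi : Function.Injective i)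

include hi

theorem exists_comp_eq_of_subsingleton_ext
    [Subsingleton (Abelian.Ext (ModuleCat.of Λ (Y ⧸ LinearMap.range i)) (ModuleCat.of Λ Z) 1)]
    (h : Q →ₗ[Λ] Z) : ∃ a : Y →ₗ[Λ] Z, a ∘ₗ i = h := by
  let T : ShortComplex (ModuleCat.{v} Λ) :=
    .mk (ModuleCat.ofHom i) (ModuleCat.ofHom (LinearMap.range i).mkQ)
      (ModuleCat.hom_ext (LinearMap.range_mkQ_comp i))
  have hT : T.ShortExact := ModuleCat.shortComplex_shortExact T
    (LinearMap.exact_map_mkQ_range i) hi (Submodule.mkQ_surjective _)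
  obtain ⟨x, hx⟩ := Abelian.Ext.contravariant_sequence_exact₁ hT (ModuleCat.of Λ Z)
    (Abelian.Ext.mk₀ (ModuleCat.ofHom h)) (add_zero 1) (Subsingleton.elim (α := Abelian.Ext
      (ModuleCat.of Λ (Y ⧸ LinearMap.range i)) (ModuleCat.of Λ Z) 1) _ _)
  obtain ⟨a, rfl⟩ := (Abelian.Ext.mk₀_bijective _ _).2 x
  rw [Abelian.Ext.mk₀_comp_mk₀] at hx
  exact ⟨a.hom, congrArg ModuleCat.Hom.hom ((Abelian.Ext.mk₀_bijective _ _).1 hx)⟩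

-- That is, every first order deformation of a presentation `i` of a rigid module is induced by
-- automorphisms of `Q` and `Y`.
theorem exists_comp_sub_comp_eq [Module.Projective Λ Y]
    [Subsingleton (Abelian.Ext (ModuleCat.of Λ (Y ⧸ LinearMap.range i))
      (ModuleCat.of Λ (Y ⧸ LinearMap.range i)) 1)] (h : Q →ₗ[Λ] Y) :
    ∃ (A : Y →ₗ[Λ] Y) (B : Q →ₗ[Λ] Q), A ∘ₗ i - i ∘ₗ B = h := by
  obtain ⟨a, ha⟩ := exists_comp_eq_of_subsingleton_ext hi ((LinearMap.range i).mkQ ∘ₗ h)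
  obtain ⟨A, rfl⟩ := Module.projective_lifting_property (LinearMap.range i).mkQ a
    (Submodule.mkQ_surjective _)
  have hmem : ∀ q, (A ∘ₗ i - h) q ∈ LinearMap.range i := fun q => by
    rw [← (LinearMap.range i).ker_mkQ, LinearMap.mem_ker, LinearMap.sub_apply, map_sub, sub_eq_zero]
    exact LinearMap.congr_fun ha q
  let e := LinearEquiv.ofInjective i hi
  have hB : i ∘ₗ e.symm.toLinearMap ∘ₗ (A ∘ₗ i - h).codRestrict _ hmem = A ∘ₗ i - h :=
    LinearMap.ext fun q => congrArg Subtype.val (e.apply_symm_apply ⟨_, hmem q⟩)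
  exact ⟨A, _, by rw [hB, sub_sub_cancel]⟩

end Rigidity

section Deformations

variable {K : Type u} [Field K] {Λ : Type v} [Ring Λ] [Algebra K Λ]
  {V : Type*} [AddCommGroup V] [Module K V]
  {Q Y : Type v} [AddCommGroup Q] [Module Λ Q] [Module K Q] [IsScalarTower K Λ Q]
  [Module.Finite K Q] [AddCommGroup Y] [Module Λ Y] [Module K Y] [IsScalarTower K Λ Y]
  [Module.Finite K Y]

theorem bijective_of_det_restrictScalars_ne_zero {A : Y →ₗ[Λ] Y}
    (hA : LinearMap.det (A.restrictScalars K) ≠ 0) : Function.Bijective A :=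
  (Module.End.isUnit_iff (A.restrictScalars K)).1
    ((LinearMap.isUnit_iff_isUnit_det _).2 (isUnit_iff_ne_zero.2 hA))

theorem IsPolyMap.det_restrictScalars_mem_polyFun {A : V → (Y →ₗ[Λ] Y)} (hA : IsPolyMap K A) :
    (fun x => LinearMap.det ((A x).restrictScalars K)) ∈ polyFun K V :=
  ((IsPolyMap.linearMap (LinearMap.restrictScalarsₗ K Λ Y Y K)).comp hA).mem_polyFun_comp
    det_mem_polyFun

variable {i : V → (Q →ₗ[Λ] Y)} (hi : IsPolyMap K i) {x₀ : V}

include hi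

theorem exists_comp_eq_comp_of_infinitesimal
    (hsurj : ∀ h : Q →ₗ[Λ] Y, ∃ (A : Y →ₗ[Λ] Y) (B : Q →ₗ[Λ] Q), A ∘ₗ i x₀ - i x₀ ∘ₗ B = h) :
    ∃ (A : V → (Y →ₗ[Λ] Y)) (B : V → (Q →ₗ[Λ] Q)), IsPolyMap K A ∧ IsPolyMap K B ∧
      A x₀ = LinearMap.id ∧ B x₀ = LinearMap.id ∧ ∀ x, A x ∘ₗ i x₀ = i x ∘ₗ B x := by
  have : Module.Finite K (Q →ₗ[Λ] Y) :=
    .of_injective (LinearMap.restrictScalarsₗ K Λ Q Y K) (LinearMap.restrictScalars_injective K)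
  let left : (Y →ₗ[Λ] Y) × (Q →ₗ[Λ] Q) →ₗ[K] (Q →ₗ[Λ] Y) :=
    LinearMap.lcomp K Y (i x₀) ∘ₗ LinearMap.fst K _ _
  let right : (Q →ₗ[Λ] Y) →ₗ[K] (Y →ₗ[Λ] Y) × (Q →ₗ[Λ] Q) →ₗ[K] (Q →ₗ[Λ] Y) :=
    LinearMap.mk₂ K (fun j e => j ∘ₗ e.2) (fun _ _ _ => LinearMap.add_comp _ _ _)
      (fun _ _ _ => LinearMap.smul_comp _ _ _) (fun _ _ _ => LinearMap.comp_add _ _ _)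
      (fun r j e => (LinearMap.compRight K j).map_smul r e.2)
  obtain ⟨G, hG, hG₀, hGx⟩ := exists_isPolyMap_forall_apply_eq_zero
    (L := fun x => left - right (i x)) ((IsPolyMap.const left).sub (.comp (.linearMap right) hi))
    (x₀ := x₀) (e := (LinearMap.id, LinearMap.id))
    (fun h => by
      obtain ⟨A, B, hAB⟩ := hsurj h
      exact ⟨(A, B), hAB⟩)
    (sub_self (i x₀))
  exact ⟨fun x => (G x).1, fun x => (G x).2, .comp (.linearMap (LinearMap.fst K _ _)) hG,
    .comp (.linearMap (LinearMap.snd K _ _)) hG, congrArg Prod.fst hG₀, congrArg Prod.snd hG₀,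
    fun x => sub_eq_zero.1 (hGx x)⟩

theorem exists_mem_polyFun_forall_nonempty_coker_equiv
    (hsurj : ∀ h : Q →ₗ[Λ] Y, ∃ (A : Y →ₗ[Λ] Y) (B : Q →ₗ[Λ] Q), A ∘ₗ i x₀ - i x₀ ∘ₗ B = h) :
    ∃ F ∈ polyFun K V, F x₀ ≠ 0 ∧ ∀ x, F x ≠ 0 →
      Nonempty ((Y ⧸ LinearMap.range (i x₀)) ≃ₗ[Λ] Y ⧸ LinearMap.range (i x)) := by
  obtain ⟨A, B, hA, hB, hA₀, hB₀, hAB⟩ := exists_comp_eq_comp_of_infinitesimal hi hsurj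
  refine ⟨_, mul_mem hA.det_restrictScalars_mem_polyFun hB.det_restrictScalars_mem_polyFun, ?_,
    fun x hx => ?_⟩
  · simp [hA₀, hB₀]
  · have hAx := bijective_of_det_restrictScalars_ne_zero (left_ne_zero_of_mul hx)
    have hBx := bijective_of_det_restrictScalars_ne_zero (right_ne_zero_of_mul hx)
    refine ⟨Submodule.Quotient.equiv _ _ (LinearEquiv.ofBijective (A x) hAx) ?_⟩
    calc (LinearMap.range (i x₀)).map (A x) = LinearMap.range (i x ∘ₗ B x) := by
          rw [← LinearMap.range_comp, hAB]
      _ = LinearMap.range (i x) :=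
          LinearMap.range_comp_of_range_eq_top _ (LinearMap.range_eq_top.2 hBx.2)

theorem isOpen_setOf_nonempty_coker_equiv [Module.Projective Λ Y]
    (hinj : ∀ x, Function.Injective (i x)) (N : Type v) [AddCommGroup N] [Module Λ N]
    [Subsingleton (Abelian.Ext (ModuleCat.of Λ N) (ModuleCat.of Λ N) 1)] :
    @IsOpen V (zariski K V) {x | Nonempty ((Y ⧸ LinearMap.range (i x)) ≃ₗ[Λ] N)} := by
  refine zariski_isOpen_iff.2 fun x₀ ⟨e⟩ => ?_
  have := subsingleton_ext_of_iso (r := 1) e.symm.toModuleIso e.symm.toModuleIso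
  obtain ⟨F, hF, hF₀, hFx⟩ := exists_mem_polyFun_forall_nonempty_coker_equiv hi
    (exists_comp_sub_comp_eq (hinj x₀))
  exact ⟨F, hF, hF₀, fun x hx => (hFx x hx).map fun e' => e'.symm ≪≫ₗ e⟩

end Deformations

section IsoLocus

variable (K : Type u) [Field K] {Λ : Type v} [Ring Λ] [Algebra K Λ] [Module.Finite K Λ] {n : ℕ}
  {S P : Fin n → ModuleCat.{v} Λ} (hS : IsSimpleList S) {π : ∀ i, P i →ₗ[Λ] S i}
  (hπ : ∀ i, IsProjectiveCover (π i)) {d : Fin n → Fin n → ℕ}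
  (φ : ∀ j, PowerSum P (d j) ≃ₗ[Λ] Module.jacobson Λ (P j)) (γ : Fin n → ℕ)

include hS hπ

theorem isOpen_isoLocus (N : Type v) [AddCommGroup N] [Module Λ N]
    [Subsingleton (Abelian.Ext (ModuleCat.of Λ N) (ModuleCat.of Λ N) 1)] :
    @IsOpen _ (zariski K _) (isoLocus K P d φ γ N) := by
  have := hS.simple
  have := fun i => (hπ i).projective
  have := fun i => (hπ i).finite
  have := projective_powerSum (P := P) γ
  have := IsArtinianRing.of_finite K Λ
  have := fun i => Module.Finite.trans (R := K) Λ (P i)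
  have : Module.Finite K (Module.jacobson Λ (PowerSum P γ)) :=
    .of_injective ((Module.jacobson Λ (PowerSum P γ)).subtype.restrictScalars K)
      (Submodule.subtype_injective _)
  exact isOpen_setOf_nonempty_coker_equiv
    (IsPolyMap.subtype_sub_const (Rep K P d φ γ) (Module.jacobson Λ (PowerSum P γ)).subtype)
    (fun f => sub_subtype_injective hS hπ φ K f.2) N

theorem isoLocus_nonempty (N : Type v) [AddCommGroup N] [Module Λ N] [Module.Finite Λ N]
    (hN : dimVec P (ModuleCat.of Λ N) = γ) : (isoLocus K P d φ γ N).Nonempty := by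
  have := IsArtinianRing.of_finite K Λ
  obtain ⟨f, hf, e⟩ := exists_mem_rep_nonempty_repModule_equiv hS hπ φ K hN
  exact ⟨⟨f, hf⟩, e⟩

end IsoLocus

end GenericDecomposition

open GenericDecomposition in
theorem corollary2p1p8_general
    {K : Type u} [Field K] [Infinite K]
    {Λ : Type v} [Ring Λ] [Algebra K Λ] [Module.Finite K Λ]
    {n : ℕ} {S P : Fin n → ModuleCat.{v} Λ}
    (hS : IsSimpleList S) {π : ∀ i, P i →ₗ[Λ] S i} (hπ : ∀ i, IsProjectiveCover (π i))
    {d : Fin n → Fin n → ℕ} (φ : ∀ j, PowerSum P (d j) ≃ₗ[Λ] Module.jacobson Λ (P j))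
    {k : ℕ} (M : Fin k → ModuleCat.{v} Λ) [∀ i, Module.Finite Λ (M i)]
    (hext : ∀ i j, Subsingleton (CategoryTheory.Abelian.Ext (M i) (M j) 1))
    (m : Fin k → ℕ) (γ : Fin n → ℕ) (hγ : γ = ∑ i, m i • dimVec P (M i)) :
    @IsOpen (Rep K P d φ γ) (zariski K _) (isoLocus K P d φ γ (PowerSum M m)) ∧
      @Dense (Rep K P d φ γ) (zariski K _) (isoLocus K P d φ γ (PowerSum M m)) := by
  let := zariski K (Rep K P d φ γ)
  have := zariski_preirreducibleSpace K (Rep K P d φ γ)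
  have := subsingleton_ext_powerSum hext m
  have := IsArtinianRing.of_finite K Λ
  have hopen := isOpen_isoLocus K hS hπ φ γ (PowerSum M m)
  exact ⟨hopen, hopen.dense (isoLocus_nonempty K hS hπ φ γ (PowerSum M m)
    ((dimVec_powerSum hS hπ φ M m).trans hγ.symm))⟩

theorem corollary2p1p8
    {K : Type u} [Field K] [Infinite K]
    {Λ : Type v} [Ring Λ] [Algebra K Λ] [Module.Finite K Λ]
    (hΛ : GenericDecomposition.IsHereditary Λ)
    {n : ℕ} (S P : Fin n → ModuleCat.{v} Λ)
    (hS : GenericDecomposition.IsSimpleList S)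
    (π : ∀ i, P i →ₗ[Λ] S i)
    (hπ : ∀ i, GenericDecomposition.IsProjectiveCover (π i))
    (φ : ∀ j, GenericDecomposition.PowerSum P (GenericDecomposition.extDim S j) ≃ₗ[Λ]
      Module.jacobson Λ (P j))
    {k : ℕ} (α : Fin k → Fin n → ℕ)
    (hα : ∀ i, GenericDecomposition.IsRealSchurRoot P (α i))
    (M : Fin k → ModuleCat.{v} Λ)
    (hM : ∀ i, GenericDecomposition.IsExceptional (M i))
    (hdim : ∀ i, GenericDecomposition.dimVec P (M i) = α i)
    (hext : ∀ i j, Subsingleton (CategoryTheory.Abelian.Ext (M i) (M j) 1))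
    (m : Fin k → ℕ) (γ : Fin n → ℕ) (hγ : γ = ∑ i, m i • α i) :
    @IsOpen _ (GenericDecomposition.zariski K _)
      (GenericDecomposition.isoLocus K P (GenericDecomposition.extDim S) φ γ
        (GenericDecomposition.PowerSum M m)) ∧
    @Dense _ (GenericDecomposition.zariski K _)
      (GenericDecomposition.isoLocus K P (GenericDecomposition.extDim S) φ γ
        (GenericDecomposition.PowerSum M m)) := by
  have := fun i => (hM i).finite
  exact corollary2p1p8_general hS hπ φ M hext m γ (by simp only [hγ, hdim])
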